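/- A lattice polytope in $\mathbb{R}^n$ is the convex hull of a finite nonempty subset of $\mathbb{Z}^n$; it need not be full-dimensional, and it is called a $d$-polytope if its affine span has dimension $d$. Two lattice polytopes $P\subset\mathbb{R}^n$ and $P'\subset\mathbb{R}^{n'}$ are equivalent if there is an affine isomorphism $\operatorname{aff}P\to\operatorname{aff}P'$ that maps $\mathbb{Z}^n\cap\operatorname{aff}P$ bijectively to $\mathbb{Z}^{n'}\cap\operatorname{aff}P'$ and maps $P$ onto $P'$. Let $V$ be the linear space parallel to $\operatorname{aff}P$, with lattice $M=V\cap\mathbb{Z}^n$ and dual lattice $M^*=\operatorname{Hom}(M,\mathbb{Z})\subset V^*$. The normal fan of $P$ consists of the cones $\sigma(P,F)=\{\varphi\in V^* : \varphi(y-x)\ge 0 \text{ for all } x\in F,\ y\in P\}$, where $F$ ranges over the nonempty faces of $P$. A cone $\sigma\subset V^*$ is unimodular if it is generated by a linearly independent set that is a $\mathbb{Z}$-basis of the lattice $M^*\cap\operatorname{span}\sigma$. The polytope $P$ is smooth if every cone in its normal fan is unimodular. **Theorem.** For all nonnegative integers $d$ and $N$, there are only finitely many equivalence classes of smooth $d$-polytopes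 $P$ such that exactly $N+1$ lattice points lie on the union of the edges (the one-dimensional faces) of $P$. -/

import Mathlib

/-- The integer lattice `ℤⁿ` inside `ℝⁿ`. -/
def IntLattice (n : ℕ) : Set (Fin n → ℝ) := {x | ∀ i, ∃ k : ℤ, x i = k}

/-- A (nonempty) lattice polytope in `ℝⁿ`: the convex hull of a finite nonempty set of
lattice points. It need not be full-dimensional. -/
structure LatticePolytope (n : ℕ) where
  /-- the underlying set of points -/
  carrier : Set (Fin n → ℝ)
  exists_finset : ∃ s : Finset (Fin n → ℝ),
    s.Nonempty ∧ ↑s ⊆ IntLattice n ∧ carrier = convexHull ℝ (s : Set (Fin n → ℝ))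

namespace LatticePolytope

variable {n m : ℕ}

/-- The linear space parallel to the affine span of `P`. -/
abbrev direction (P : LatticePolytope n) : Submodule ℝ (Fin n → ℝ) := vectorSpan ℝ P.carrier

/-- The dimension of `P`, that is, of its affine span. -/
noncomputable def dim (P : LatticePolytope n) : ℕ := Module.finrank ℝ P.direction

/-- The nonempty faces of `P`, including `P` itself: the sets of the points of `P` at which some
linear functional is maximal on `P`. -/
def IsFace (P : LatticePolytope n) (F : Set (Fin n → ℝ)) : Prop :=
  F.Nonempty ∧ IsExposed ℝ P.carrier F

/-- The edges of `P`: its one-dimensional faces. -/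
def IsEdge (P : LatticePolytope n) (F : Set (Fin n → ℝ)) : Prop :=
  P.IsFace F ∧ Module.finrank ℝ (vectorSpan ℝ F) = 1

/-- The set of lattice points that lie on some edge of `P`. -/
def edgeLatticePoints (P : LatticePolytope n) : Set (Fin n → ℝ) :=
  {x | x ∈ IntLattice n ∧ ∃ F, P.IsEdge F ∧ x ∈ F}

theorem carrier_nonempty (P : LatticePolytope n) : P.carrier.Nonempty := by
  obtain ⟨s, hs, -, h⟩ := P.exists_finset
  rw [h]
  exact hs.to_set.convexHull

instance (P : LatticePolytope n) : Nonempty (affineSpan ℝ P.carrier) :=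
  ((affineSpan_nonempty ℝ).2 P.carrier_nonempty).to_subtype

/-! ### Normal fan and smoothness

Let `V` be the direction of `P`, with the lattice `M = V ∩ ℤⁿ`. The normal fan of `P` lives in the
dual space of `V`, which carries the dual lattice `N = Hom(M, ℤ)`. -/

/-- The dual lattice `N = Hom(M, ℤ)`: the functionals on `V` that are integral on `M = V ∩ ℤⁿ`. -/
def dualLattice (P : LatticePolytope n) : Set (Module.Dual ℝ P.direction) :=
  {φ | ∀ v : P.direction, (v : Fin n → ℝ) ∈ IntLattice n → ∃ k : ℤ, φ v = k}

/-- The normal cone of `P` at the face `F`: the dual of the tangent cone, that is, the functionals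
`φ` with `φ (y - x) ≥ 0` for all `x ∈ F` and `y ∈ P`. -/
noncomputable def normalCone (P : LatticePolytope n) (F : Set (Fin n → ℝ)) :
    PointedCone ℝ (Module.Dual ℝ P.direction) :=
  PointedCone.dual (Module.Dual.eval ℝ P.direction)
    {v : P.direction | ∃ x ∈ F, ∃ y ∈ P.carrier, (v : Fin n → ℝ) = y - x}

/-- The normal fan of `P`: the collection of the normal cones at all nonempty faces of `P`. -/
def normalFan (P : LatticePolytope n) : Set (PointedCone ℝ (Module.Dual ℝ P.direction)) :=
  {σ | ∃ F, P.IsFace F ∧ σ = P.normalCone F}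

end LatticePolytope

/-- A cone `σ` in a real vector space `W` with lattice `L` is unimodular if it is generated by a
finite linearly independent set which is a basis of the lattice `L ∩ span σ`. (The members of such
a set are then exactly the primitive minimal generators of `σ`. For a cone `σ` of full dimension,
`L ∩ span σ` is `L`.) -/
def IsUnimodularCone {W : Type*} [AddCommGroup W] [Module ℝ W] (L : Set W)
    (σ : PointedCone ℝ W) : Prop :=
  ∃ B : Finset W,
    LinearIndependent ℝ (fun b : B => (b : W)) ∧
    (Submodule.span ℤ (B : Set W) : Set W) = L ∩ (Submodule.span ℝ (σ : Set W) : Set W) ∧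
    σ = PointedCone.hull ℝ (B : Set W)

namespace LatticePolytope

variable {n m : ℕ}

/-- `P` is smooth if every cone of its normal fan is unimodular with respect to the lattice `N`. -/
def IsSmooth (P : LatticePolytope n) : Prop :=
  ∀ σ ∈ P.normalFan, IsUnimodularCone P.dualLattice σ

/-- Integral equivalence: there is a bijective affine map `aff P → aff Q` that maps
`ℤⁿ ∩ aff P` onto `ℤᵐ ∩ aff Q` and `P` onto `Q`. -/
def IntegrallyEquivalent (P : LatticePolytope n) (Q : LatticePolytope m) : Prop :=
  ∃ e : affineSpan ℝ P.carrier ≃ᵃ[ℝ] affineSpan ℝ Q.carrier,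
    e '' {x : affineSpan ℝ P.carrier | (x : Fin n → ℝ) ∈ IntLattice n} =
      {y : affineSpan ℝ Q.carrier | (y : Fin m → ℝ) ∈ IntLattice m} ∧
    e '' {x : affineSpan ℝ P.carrier | (x : Fin n → ℝ) ∈ P.carrier} =
      {y : affineSpan ℝ Q.carrier | (y : Fin m → ℝ) ∈ Q.carrier}

/-- Integral equivalence as an equivalence relation on the lattice polytopes in all `ℝⁿ`. -/
instance integralSetoid : Setoid (Σ n, LatticePolytope n) where
  r P Q := IntegrallyEquivalent P.2 Q.2
  iseqv :=
    { refl := fun P => ⟨AffineEquiv.refl ℝ _, by simp, by simp⟩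
      symm := by
        rintro P Q ⟨e, h₁, h₂⟩
        refine ⟨e.symm, ?_, ?_⟩
        · rw [← h₁, ← Set.image_comp]; simp
        · rw [← h₂, ← Set.image_comp]; simp
      trans := by
        rintro P Q R ⟨e, h₁, h₂⟩ ⟨f, h₃, h₄⟩
        refine ⟨e.trans f, ?_, ?_⟩
        · rw [← h₃, ← h₁, ← Set.image_comp]; rfl
        · rw [← h₄, ← h₂, ← Set.image_comp]; rfl }

end LatticePolytope

/-! At a vertex of a smooth polytope the primitive edge directions form a lattice basis
(`IsVertexSet.exists_basis`). In positive dimension every vertex lies on an edge, so there are at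
most `N + 1` vertices, and every edge has lattice length at most `N`. It remains to show that, in
the basis at one fixed vertex, all vertices have coordinates bounded in terms of `N`; an equivalent
copy of the polytope then lies in a fixed box, which contains only finitely many lattice polytopes.

Along an edge from `p` to `q` in direction `b i`, the basis changes by `b i ↦ -b i` and `b j ↦ b j +
a • b i` with integers `a` (`exists_opposite`, `exists_transport`). The key estimate
`abs_transition_le` bounds `a`. It looks at the polygon that is the 2-face spanned by `b i` and `b
j`: its two sides leave the edge `pq` with inverse slopes differing by `a`, each vertex on the way
up changes an inverse slope by at most one in the closing direction, and the top has width at most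
`N`. If `a` were large, the sides could not meet. Thus each step along an edge multiplies
coordinates of edge directions by a bounded factor, and a monotone path visits at most all vertices.
-/

/-- The vertices of a smooth polytope, together with the basis formed by the primitive edge
directions at each vertex; all edges have lattice length at most `N`. -/
structure SmoothConfig (ι V : Type*) [AddCommGroup V] [Module ℝ V] (d N : ℕ) where
  /-- the vertices -/
  pt : ι → V
  /-- the primitive edge directions at a vertex -/
  basis : ι → Module.Basis (Fin d) ℝ V
  exists_int : ∀ p q i j, ∃ k : ℤ, (basis p).repr (basis q j) i = k
  nonneg : ∀ p q i, 0 ≤ (basis p).repr (pt q - pt p) i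
  edge : ∀ p i, ∃ q, ∃ l : ℕ, 1 ≤ l ∧ l ≤ N ∧ pt q = pt p + (l : ℝ) • basis p i ∧
    ∀ r (t : ℝ), pt r = pt p + t • basis p i → t ≤ l
  exposed : ∀ p, ∃ g : V →ₗ[ℝ] ℝ, ∀ q, q ≠ p → g (pt q) < g (pt p)

/-! ### Change of the vertex basis along an edge. -/

namespace SmoothConfig

variable {ι V : Type*} [AddCommGroup V] [Module ℝ V] {d N : ℕ}

/-- Away from coordinate `i`, the neighbour of `q` along `k` has, seen from `p`, the coordinates of
a positive multiple of `basis q k`; vertices have nonnegative coordinates. -/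
theorem transverse_nonneg (C : SmoothConfig ι V d N) {p q : ι} {i : Fin d} {t : ℝ}
    (h : C.pt q = C.pt p + t • C.basis p i) (k : Fin d) {j : Fin d} (hj : j ≠ i) :
    0 ≤ (C.basis p).repr (C.basis q k) j := by
  obtain ⟨r, l, hl, -, hr, -⟩ := C.edge q k
  have h1 := C.nonneg p r j
  have h2 : C.pt r - C.pt p = t • C.basis p i + (l : ℝ) • C.basis q k := by
    rw [hr, h]; abel
  rw [h2] at h1
  simp [hj.symm] at h1
  have : (0 : ℝ) < l := by exact_mod_cast hl
  exact nonneg_of_mul_nonneg_right h1 this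

/-- The vector from `q` to `p` is a nonnegative combination of the directions at `q`. Transverse
coordinates are nonnegative and cancel, so a direction that occurs is parallel to `basis p i`;
integrality both ways makes the factor a unit, and its sign is negative. -/
theorem exists_opposite (C : SmoothConfig ι V d N) {p q : ι} {i : Fin d} {t : ℝ} (ht : 0 < t)
    (h : C.pt q = C.pt p + t • C.basis p i) : ∃ k, C.basis q k = -C.basis p i := by
  have hc := C.nonneg q p
  have hpq : C.pt p - C.pt q = (-t) • C.basis p i := by rw [h, neg_smul]; abel
  set c := (C.basis q).repr (C.pt p - C.pt q) with hcdef
  have hsum : ∑ k, c k • C.basis q k = (-t) • C.basis p i := by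
    rw [← hpq]; exact (C.basis q).sum_repr _
  have hex : ∃ k, 0 < c k := by
    by_contra! hno
    have h0 : ∀ k, c k = 0 := fun k => le_antisymm (hno k) (hc k)
    simp only [h0, zero_smul, Finset.sum_const_zero] at hsum
    have := (C.basis p).ne_zero i
    rcases smul_eq_zero.1 hsum.symm with h' | h'
    · linarith
    · exact this h'
  obtain ⟨k, hk⟩ := hex
  have hz : ∀ j, j ≠ i → (C.basis p).repr (C.basis q k) j = 0 := by
    intro j hj
    have h1 := congrArg (fun v => (C.basis p).repr v j) hsum
    simp [hj.symm] at h1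
    have h2 := (Finset.sum_eq_zero_iff_of_nonneg
      (fun k _ => mul_nonneg (hc k) (C.transverse_nonneg h k hj))).1 h1 k (Finset.mem_univ _)
    exact (mul_eq_zero.1 h2).resolve_left hk.ne'
  obtain ⟨s, hs⟩ := C.exists_int p q i k
  obtain ⟨r, hr⟩ := C.exists_int q p k i
  have hqk : C.basis q k = (s : ℝ) • C.basis p i := by
    apply (C.basis p).ext_elem
    intro j
    by_cases hj : j = i
    · subst hj; simp [hs]
    · rw [hz j hj]; simp [Ne.symm hj]
  have hsr : (s : ℝ) * r = 1 := by
    have h1 := congrArg (fun v => (C.basis q).repr v k) hqk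
    simp [hr] at h1
    exact h1.symm
  have hck : c k = -t * r := by
    rw [hcdef, hpq]; simp [hr]
  have hr0 : (r : ℝ) < 0 := by
    rw [hck] at hk; nlinarith
  have hsr' : s * r = 1 := by exact_mod_cast hsr
  have hr0' : r < 0 := by exact_mod_cast hr0
  have hs1 : s = -1 := by
    rcases Int.eq_one_or_neg_one_of_mul_eq_one hsr' with h' | h'
    · subst h'; omega
    · exact h'
  exact ⟨k, by rw [hqk, hs1]; simp⟩

/-- Modulo `basis p i`, the two transition matrices between `p` and `q` are nonnegative, integral
and mutually inverse, hence permutation matrices. -/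
theorem exists_transport (C : SmoothConfig ι V d N) {p q : ι} {i k₀ : Fin d} {t : ℝ}
    (h : C.pt q = C.pt p + t • C.basis p i) (hk₀ : C.basis q k₀ = -C.basis p i)
    {j : Fin d} (hj : j ≠ i) :
    ∃ k, k ≠ k₀ ∧ ∃ a : ℤ, C.basis q k = C.basis p j + (a : ℝ) • C.basis p i := by
  have h' : C.pt p = C.pt q + t • C.basis q k₀ := by rw [h, hk₀, smul_neg]; abel
  set c := (C.basis q).repr (C.basis p j) with hcdef
  have hsum : ∑ k, c k • C.basis q k = C.basis p j := (C.basis q).sum_repr _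
  have hterm : ∀ m, m ≠ i → ∀ k, 0 ≤ c k * (C.basis p).repr (C.basis q k) m := by
    intro m hm k
    by_cases hk : k = k₀
    · subst hk; rw [hk₀]; simp [hm.symm]
    · exact mul_nonneg (C.transverse_nonneg h' j hk) (C.transverse_nonneg h k hm)
  have hcoord : ∀ m, ∑ k, c k * (C.basis p).repr (C.basis q k) m =
      (C.basis p).repr (C.basis p j) m := by
    intro m
    have h1 := congrArg (fun v => (C.basis p).repr v m) hsum
    simpa using h1
  have hex : ∃ k, 0 < c k * (C.basis p).repr (C.basis q k) j := by
    by_contra! hno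
    have h1 := hcoord j
    rw [Finset.sum_eq_zero fun k _ => le_antisymm (hno k) (hterm j hj k)] at h1
    simp at h1
  obtain ⟨k, hk⟩ := hex
  have hkk : k ≠ k₀ := by
    rintro rfl
    rw [hk₀] at hk
    simp [hj.symm] at hk
  have hle : c k * (C.basis p).repr (C.basis q k) j ≤ 1 := by
    have h1 := hcoord j
    have h2 := Finset.single_le_sum (fun k _ => hterm j hj k) (Finset.mem_univ k)
    rw [h1] at h2
    simpa using h2
  obtain ⟨x, hx⟩ := C.exists_int q p k j
  obtain ⟨y, hy⟩ := C.exists_int p q j k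
  obtain ⟨a, ha⟩ := C.exists_int p q i k
  have hx0 := C.transverse_nonneg h' j hkk
  have hy0 := C.transverse_nonneg h k hj
  change 0 ≤ c k at hx0
  have hxc : c k = x := hx
  rw [hxc] at hk hle hx0
  rw [hy] at hk hle hy0
  have hy1 : y = 1 := by
    have k1 : 0 < x * y := by exact_mod_cast hk
    have k2 : x * y ≤ 1 := by exact_mod_cast hle
    have k3 : 0 ≤ y := by exact_mod_cast hy0
    have k4 : x * y = 1 := by omega
    rw [mul_comm] at k4
    rcases Int.eq_one_or_neg_one_of_mul_eq_one k4 with h' | h' <;> omega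
  have hxpos : c k ≠ 0 := by
    rintro h0
    rw [← hxc, h0] at hk
    simp at hk
  refine ⟨k, hkk, a, (C.basis p).ext_elem fun m => ?_⟩
  by_cases hm : m = i
  · subst hm; simp [ha, hj]
  · by_cases hmj : m = j
    · subst hmj; simp [hy, hy1, Ne.symm hm]
    · have h1 := hcoord m
      have h2 : (C.basis p).repr (C.basis p j) m = 0 := by
        simp [Ne.symm hmj]
      rw [h2] at h1
      have h3 := (Finset.sum_eq_zero_iff_of_nonneg (fun k _ => hterm m hm k)).1 h1 k
        (Finset.mem_univ _)
      rw [(mul_eq_zero.1 h3).resolve_left hxpos]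
      simp [Ne.symm hm, Ne.symm hmj]

/-- The neighbour of `p` along the `i`-th edge, with the edge directions there. -/
theorem exists_neighbor (C : SmoothConfig ι V d N) (p : ι) (i : Fin d) :
    ∃ q, ∃ l : ℕ, ∃ k₀, 1 ≤ l ∧ l ≤ N ∧ C.pt q = C.pt p + (l : ℝ) • C.basis p i ∧
      C.basis q k₀ = -C.basis p i ∧
      ∀ j, j ≠ i → ∃ k, k ≠ k₀ ∧ ∃ a : ℤ, C.basis q k = C.basis p j + (a : ℝ) • C.basis p i := by
  obtain ⟨q, l, hl, hlN, hq, -⟩ := C.edge p i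
  obtain ⟨k₀, hk₀⟩ := C.exists_opposite (by exact_mod_cast hl) hq
  exact ⟨q, l, k₀, hl, hlN, hq, hk₀, fun j hj => C.exists_transport hq hk₀ hj⟩

theorem eq_add_of_mem_span (C : SmoothConfig ι V d N) {p r : ι} {i j : Fin d} (hij : i ≠ j)
    (h : C.pt r - C.pt p ∈ Submodule.span ℝ {C.basis p i, C.basis p j}) :
    ∃ s t : ℝ, 0 ≤ s ∧ 0 ≤ t ∧ C.pt r = C.pt p + s • C.basis p i + t • C.basis p j := by
  obtain ⟨s, t, hst⟩ := Submodule.mem_span_pair.1 h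
  have hi := C.nonneg p r i
  have hj := C.nonneg p r j
  rw [← hst] at hi hj
  simp [hij, hij.symm] at hi hj
  refine ⟨s, t, hi, hj, ?_⟩
  rw [add_assoc, hst]; abel

/-! ### Bounding the transition coefficients inside a 2-face. -/

/-- Walking up one side of a two-dimensional face of a smooth polytope: the inverse slope drops by
at most one at each vertex. -/
theorem exists_top (C : SmoothConfig ι V d N) [Fintype ι] (X Y : V →ₗ[ℝ] ℝ)
    (hY : ∀ p i, ∃ k : ℤ, Y (C.basis p i) = k) (m : ℕ) :
    ∀ (p : ι) (i j : Fin d) (c : ℝ), i ≠ j →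
      X (C.basis p i) * Y (C.basis p j) - Y (C.basis p i) * X (C.basis p j) = 1 →
      0 < Y (C.basis p i) → {r | Y (C.pt p) < Y (C.pt r)}.ncard ≤ m →
      -c * Y (C.basis p i) ≤ X (C.basis p i) →
      ∃ z, C.pt z - C.pt p ∈ Submodule.span ℝ {C.basis p i, C.basis p j} ∧
        Y (C.pt p) + 1 ≤ Y (C.pt z) ∧
        -(c + m) * (Y (C.pt z) - Y (C.pt p)) ≤ X (C.pt z) - X (C.pt p) ∧
        ∀ r, C.pt r - C.pt p ∈ Submodule.span ℝ {C.basis p i, C.basis p j} →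
          Y (C.pt r) ≤ Y (C.pt z) ∧ (Y (C.pt r) = Y (C.pt z) → X (C.pt z) - N ≤ X (C.pt r)) := by
  have hpos : ∀ p i, 0 < Y (C.basis p i) → 1 ≤ Y (C.basis p i) := by
    intro p i h
    obtain ⟨k, hk⟩ := hY p i
    rw [hk] at h ⊢
    exact_mod_cast h
  induction m with
  | zero =>
    intro p i j c hij hdet hYi hcard
    -- The neighbour along the ascending edge lies strictly above `p`, so `m = 0` is impossible.
    obtain ⟨q, l, k₀, hl, hlN, hq, -⟩ := C.exists_neighbor p i
    rw [Nat.le_zero, Set.ncard_eq_zero (Set.toFinite _)] at hcard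
    have : q ∈ {r | Y (C.pt p) < Y (C.pt r)} := by
      have : (0 : ℝ) < l := by exact_mod_cast hl
      simp only [Set.mem_ofPred_eq, hq, map_add, map_smul, smul_eq_mul]
      nlinarith
    rw [hcard] at this
    exact this.elim
  | succ m ih =>
    intro p i j c hij hdet hYi hcard hc
    obtain ⟨q, l, k₀, hl, hlN, hq, hk₀, htr⟩ := C.exists_neighbor p i
    obtain ⟨k, hkk, a, hk⟩ := htr j hij.symm
    have hl1 : (1 : ℝ) ≤ l := by exact_mod_cast hl
    have hY1 := hpos p i hYi
    have hYq : Y (C.pt q) = Y (C.pt p) + l * Y (C.basis p i) := by simp [hq]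
    have hXq : X (C.pt q) = X (C.pt p) + l * X (C.basis p i) := by simp [hq]
    have hlY : 1 ≤ l * Y (C.basis p i) := by nlinarith
    have hspan : Submodule.span ℝ {C.basis q k, C.basis q k₀} =
        Submodule.span ℝ {C.basis p i, C.basis p j} := by
      apply le_antisymm <;> rw [Submodule.span_le, Set.pair_subset_iff] <;>
        simp only [SetLike.mem_coe, Submodule.mem_span_pair]
      · exact ⟨⟨a, 1, by rw [hk]; module⟩, ⟨-1, 0, by rw [hk₀]; module⟩⟩
      · exact ⟨⟨0, -1, by rw [hk₀]; module⟩, ⟨1, a, by rw [hk, hk₀]; module⟩⟩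
    have hqmem : C.pt q - C.pt p ∈ Submodule.span ℝ {C.basis p i, C.basis p j} :=
      Submodule.mem_span_pair.2 ⟨l, 0, by rw [hq]; module⟩
    -- At `q` the pair consists of the onward direction `k` and the backward direction `k₀`; it has
    -- the same orientation and determinant as the pair at `p`.
    have hdet' : X (C.basis q k) * Y (C.basis q k₀) - Y (C.basis q k) * X (C.basis q k₀) = 1 := by
      rw [hk, hk₀]
      simp only [map_add, map_smul, map_neg, smul_eq_mul]
      linear_combination hdet
    have hdet2 : X (C.basis p i) * Y (C.basis q k) - Y (C.basis p i) * X (C.basis q k) = 1 := by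
      rw [hk₀] at hdet'
      simp only [map_neg] at hdet'
      linear_combination hdet'
    by_cases hYk : 0 < Y (C.basis q k)
    · have hcard' : {r | Y (C.pt q) < Y (C.pt r)}.ncard ≤ m := by
        refine Nat.le_of_lt_succ (lt_of_lt_of_le (Set.ncard_lt_ncard ?_ (Set.toFinite _)) hcard)
        refine ⟨fun r hr => ?_, fun hsub => ?_⟩
        · simp only [Set.mem_ofPred_eq] at hr ⊢
          linarith
        · have : q ∈ {r | Y (C.pt q) < Y (C.pt r)} := hsub (by
            simp only [Set.mem_ofPred_eq]; linarith)
          simp at this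
      have hYk1 := hpos q k hYk
      -- By `hdet2` the inverse slope `X / Y` drops by `1 / (Y (basis p i) * Y (basis q k))`, which
      -- is at most `1` since both heights are positive integers.
      have hc' : -(c + 1) * Y (C.basis q k) ≤ X (C.basis q k) := by
        have h1 : 1 ≤ Y (C.basis p i) * Y (C.basis q k) := by nlinarith
        have h2 : 0 ≤ Y (C.basis q k) * (X (C.basis p i) + c * Y (C.basis p i)) :=
          mul_nonneg hYk.le (by linarith)
        have h3 : 0 ≤ Y (C.basis p i) * (X (C.basis q k) + (c + 1) * Y (C.basis q k)) := by
          linarith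
        have := nonneg_of_mul_nonneg_right h3 hYi
        linarith
      obtain ⟨z, hz, hz1, hz2, hz3⟩ := ih q k k₀ (c + 1) hkk hdet' hYk hcard' hc'
      rw [hspan] at hz hz3
      refine ⟨z, ?_, by linarith, ?_, fun r hr => hz3 r ?_⟩
      · have := add_mem hz hqmem
        simpa using this
      · push_cast
        have h1 : -(c * (l * Y (C.basis p i))) ≤ l * X (C.basis p i) := by nlinarith
        have h2 : 0 ≤ (m + 1 : ℝ) * (l * Y (C.basis p i)) := by positivity
        have h3 : -(c + (m + 1 : ℝ)) * (l * Y (C.basis p i)) ≤ l * X (C.basis p i) := by linarith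
        have h4 : -(c + (m + 1 : ℝ)) * (Y (C.pt z) - Y (C.pt q)) ≤ X (C.pt z) - X (C.pt q) := by
          linarith
        rw [hYq, hXq] at h4
        linarith
      · have := sub_mem hr hqmem
        simpa using this
    -- Neither direction at `q` ascends, so `q` is the top of the face.
    · refine ⟨q, hqmem, by linarith, ?_, fun r hr => ?_⟩
      · rw [hYq, hXq]
        have h1 : -(c * (l * Y (C.basis p i))) ≤ l * X (C.basis p i) := by nlinarith
        have h2 : 0 ≤ ((m + 1 : ℕ) : ℝ) * (l * Y (C.basis p i)) := by positivity
        linarith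
      · have hr' : C.pt r - C.pt q ∈ Submodule.span ℝ {C.basis q k, C.basis q k₀} := by
          rw [hspan]
          have := sub_mem hr hqmem
          simpa using this
        obtain ⟨s, t, hs, ht, hst⟩ := C.eq_add_of_mem_span hkk hr'
        have hYr : Y (C.pt r) = Y (C.pt q) + s * Y (C.basis q k) - t * Y (C.basis p i) := by
          rw [hst, hk₀]; simp; ring
        have hXr : X (C.pt r) = X (C.pt q) + s * X (C.basis q k) - t * X (C.basis p i) := by
          rw [hst, hk₀]; simp; ring
        have h1 : s * Y (C.basis q k) ≤ 0 := mul_nonpos_of_nonneg_of_nonpos hs (not_lt.1 hYk)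
        have h2 : 0 ≤ t * Y (C.basis p i) := mul_nonneg ht hYi.le
        refine ⟨by linarith, fun heq => ?_⟩
        have h3 : t * Y (C.basis p i) = 0 := by linarith
        have ht0 : t = 0 := (mul_eq_zero.1 h3).resolve_right hYi.ne'
        have h4 : s * Y (C.basis q k) = 0 := by linarith
        rcases mul_eq_zero.1 h4 with hs0 | hY0
        · rw [hXr, hs0, ht0]; simp
        -- The top is a horizontal edge: its length is at most `N`, and the determinant gives `X
        -- (basis q k) ≥ -1`.
        · obtain ⟨_, l', -, hl'N, -, hmax⟩ := C.edge q k
          have hsl := hmax r s (by rw [hst, ht0]; simp)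
          have hl'N' : (l' : ℝ) ≤ N := by exact_mod_cast hl'N
          rw [hY0] at hdet2
          have hXk : -1 ≤ X (C.basis q k) := by
            by_contra! hlt
            nlinarith
          rw [hXr, ht0]
          nlinarith

/-- The lower bound comes from the next vertex after `q` along `k`, whose `i`-coordinate `l + l' *
a` is nonnegative. The upper bound compares the two sides of the polygon through `p` and `q`. -/
theorem abs_transition_le (C : SmoothConfig ι V d N) [Fintype ι] {p q : ι} {i j k₀ k : Fin d}
    {l : ℕ} (hl : 1 ≤ l) (hlN : l ≤ N) (h : C.pt q = C.pt p + (l : ℝ) • C.basis p i)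
    (hk₀ : C.basis q k₀ = -C.basis p i) (hj : j ≠ i) (hkk : k ≠ k₀) {a : ℤ}
    (hk : C.basis q k = C.basis p j + (a : ℝ) • C.basis p i) :
    |(a : ℝ)| ≤ 2 * Fintype.card ι + N := by
  have hl1 : (1 : ℝ) ≤ l := by exact_mod_cast hl
  have hlN' : (l : ℝ) ≤ N := by exact_mod_cast hlN
  rw [abs_le]
  constructor
  · obtain ⟨r, l', hl', -, hr, -⟩ := C.edge q k
    have h1 := C.nonneg p r i
    have h2 : C.pt r - C.pt p = ((l : ℝ) + l' * a) • C.basis p i + (l' : ℝ) • C.basis p j := by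
      rw [hr, h, hk]; module
    rw [h2] at h1
    simp [hj] at h1
    have hl'1 : (1 : ℝ) ≤ l' := by exact_mod_cast hl'
    have h3 : (0 : ℝ) ≤ Fintype.card ι := by positivity
    by_contra! hlt
    nlinarith
  · set m := Fintype.card ι
    have hcard : ∀ s : Set ι, s.ncard ≤ m := fun s => by
      rw [show m = Nat.card ι from Nat.card_eq_fintype_card.symm]; exact Set.ncard_le_card s
    set Y : V →ₗ[ℝ] ℝ := (C.basis p).coord j with hYdef
    -- The shear makes the side leaving `q` vertical, while the side leaving `p` starts with inverse
    -- slope `-a`. The latter is climbed in the mirror image `-X`.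
    set X : V →ₗ[ℝ] ℝ := (C.basis p).coord i - (a : ℝ) • (C.basis p).coord j with hXdef
    have hY : ∀ r i, ∃ k : ℤ, Y (C.basis r i) = k := fun r i => C.exists_int p r j i
    have hXi : X (C.basis p i) = 1 := by simp [hXdef, hj.symm]
    have hXj : X (C.basis p j) = -a := by simp [hXdef, hj]
    have hYi : Y (C.basis p i) = 0 := by simp [hYdef, hj.symm]
    have hYj : Y (C.basis p j) = 1 := by simp [hYdef]
    have hXk : X (C.basis q k) = 0 := by rw [hk]; simp [hXi, hXj]
    have hYk : Y (C.basis q k) = 1 := by rw [hk]; simp [hYi, hYj]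
    have hXq : X (C.pt q) = X (C.pt p) + l := by rw [h]; simp [hXi]
    have hYq : Y (C.pt q) = Y (C.pt p) := by rw [h]; simp [hYi]
    obtain ⟨z, hz, hz1, hz2, hz3⟩ := C.exists_top X Y hY m q k k₀ 0 hkk
      (by rw [hk₀, map_neg, map_neg, hXi, hYi, hXk, hYk]; norm_num) (by rw [hYk]; norm_num)
      (hcard _) (by rw [hXk]; norm_num)
    obtain ⟨w, hw, hw1, hw2, hw3⟩ := C.exists_top (-X) Y hY m p j i (-a) hj
      (by simp [hXi, hYi, hYj]) (by rw [hYj]; norm_num)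
      (hcard _) (by simp [hYj, hXj])
    have hspan : Submodule.span ℝ {C.basis q k, C.basis q k₀} =
        Submodule.span ℝ {C.basis p j, C.basis p i} := by
      apply le_antisymm <;> rw [Submodule.span_le, Set.pair_subset_iff] <;>
        simp only [SetLike.mem_coe, Submodule.mem_span_pair]
      · exact ⟨⟨1, a, by rw [hk]; module⟩, ⟨0, -1, by rw [hk₀]; module⟩⟩
      · exact ⟨⟨1, a, by rw [hk, hk₀]; module⟩, ⟨0, -1, by rw [hk₀]; module⟩⟩
    have hqmem : C.pt q - C.pt p ∈ Submodule.span ℝ {C.basis p j, C.basis p i} :=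
      Submodule.mem_span_pair.2 ⟨0, l, by rw [h]; module⟩
    rw [hspan] at hz hz3
    have e1 := (hw3 z (by simpa using add_mem hz hqmem)).1
    have e2 := hz3 w (by simpa using sub_mem hw hqmem)
    have e3 := e2.2 (le_antisymm e2.1 e1)
    have e4 : Y (C.pt w) = Y (C.pt z) := le_antisymm e2.1 e1
    simp only [LinearMap.neg_apply] at hw2
    rw [hYq, hXq] at hz2
    rw [e4] at hw2
    rw [hYq] at hz1
    -- With `h = Y z - Y p ≥ 1`, the sides give `X z ≥ X p + l - m * h` and `X w ≤ X p + (m - a) *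
    -- h`, and the top gives `X z - N ≤ X w`. Hence `(a - 2 * m) * h ≤ N - l`.
    by_contra! hlt
    nlinarith

/-! ### Bounding all vertices by walks along edges. -/

/-- Moving to an adjacent vertex multiplies the coordinates of the edge directions by a bounded
factor. -/
theorem exists_step (C : SmoothConfig ι V d N) [Fintype ι] (φ : V →ₗ[ℝ] ℝ) (s : ℝ) (p : ι) (i : Fin d)
    {A D : ℝ} (hA : ∀ j, |φ (C.basis p j)| ≤ A) (hD : |φ (C.pt p) - s| ≤ D) :
    ∃ q, ∃ l : ℕ, 1 ≤ l ∧ C.pt q = C.pt p + (l : ℝ) • C.basis p i ∧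
      (∀ j, |φ (C.basis q j)| ≤ (1 + (2 * Fintype.card ι + N)) * A) ∧
      |φ (C.pt q) - s| ≤ D + N * A := by
  obtain ⟨q, l, k₀, hl, hlN, hq, hk₀, -⟩ := C.exists_neighbor p i
  have hA0 : 0 ≤ A := (abs_nonneg _).trans (hA i)
  refine ⟨q, l, hl, hq, fun j => ?_, ?_⟩
  · by_cases hj : j = k₀
    · rw [hj, hk₀, map_neg, abs_neg]
      have h1 : 0 ≤ (2 * Fintype.card ι + N : ℝ) * A := by positivity
      linarith [hA i]
    -- Transport is applied from `q` back to `p`, so that every direction `j ≠ k₀` at `q` is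
    -- reached.
    · have h' : C.pt p = C.pt q + (l : ℝ) • C.basis q k₀ := by rw [hq, hk₀]; module
      have hk₀' : C.basis p i = -C.basis q k₀ := by rw [hk₀, neg_neg]
      obtain ⟨k, hk, a, ha⟩ := C.exists_transport h' hk₀' hj
      have ha' : C.basis q j = C.basis p k + (a : ℝ) • C.basis p i := by
        rw [ha, hk₀]; module
      have hle := C.abs_transition_le hl hlN hq hk₀ hk hj ha'
      rw [ha', map_add, map_smul, smul_eq_mul]
      have h1 : |(a : ℝ) * φ (C.basis p i)| ≤ (2 * Fintype.card ι + N) * A := by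
        rw [abs_mul]
        exact mul_le_mul hle (hA i) (abs_nonneg _) (by positivity)
      linarith [abs_add_le (φ (C.basis p k)) ((a : ℝ) * φ (C.basis p i)), hA k]
  · rw [hq, map_add, map_smul, smul_eq_mul]
    have h1 : |(l : ℝ) * φ (C.basis p i)| ≤ N * A := by
      rw [abs_mul, Nat.abs_cast]
      exact mul_le_mul (by exact_mod_cast hlN) (hA i) (abs_nonneg _) (by positivity)
    rw [add_sub_right_comm]
    linarith [abs_add_le (φ (C.pt p) - s) ((l : ℝ) * φ (C.basis p i))]

/-- As in the simplex method, `g` increases along some edge until its unique maximum `w` is reached;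
`m` bounds the number of vertices still above, hence the number of steps. -/
theorem abs_le_of_walk (C : SmoothConfig ι V d N) [Fintype ι] (φ : V →ₗ[ℝ] ℝ) (s : ℝ) (w : ι)
    (g : V →ₗ[ℝ] ℝ) (hg : ∀ q, q ≠ w → g (C.pt q) < g (C.pt w)) (m : ℕ) :
    ∀ (p : ι) (A D : ℝ), (∀ j, |φ (C.basis p j)| ≤ A) → |φ (C.pt p) - s| ≤ D → 0 ≤ A →
      {r | g (C.pt p) < g (C.pt r)}.ncard ≤ m →
      |φ (C.pt w) - s| ≤ D + m * (N * ((1 + (2 * Fintype.card ι + N)) ^ m * A)) := by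
  induction m with
  | zero =>
    intro p A D hA hD hA0 hcard
    rw [Nat.le_zero, Set.ncard_eq_zero (Set.toFinite _)] at hcard
    have : p = w := by
      by_contra hne
      have : w ∈ {r | g (C.pt p) < g (C.pt r)} := hg p hne
      rw [hcard] at this
      exact this
    simpa [← this] using hD
  | succ m ih =>
    intro p A D hA hD hA0 hcard
    set K : ℝ := 1 + (2 * Fintype.card ι + N) with hK
    have hK1 : 1 ≤ K := by
      have : (0 : ℝ) ≤ 2 * Fintype.card ι + N := by positivity
      linarith
    by_cases hpw : p = w
    · subst hpw
      have : 0 ≤ ((m + 1 : ℕ) : ℝ) * (N * (K ^ (m + 1) * A)) := by positivity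
      linarith
    · have hlt := hg p hpw
      have hex : ∃ i, 0 < g (C.basis p i) := by
        by_contra! hno
        have h1 : g (C.pt w - C.pt p) ≤ 0 := by
          rw [← (C.basis p).sum_repr (C.pt w - C.pt p), map_sum]
          refine Finset.sum_nonpos fun i _ => ?_
          rw [map_smul, smul_eq_mul]
          exact mul_nonpos_of_nonneg_of_nonpos (C.nonneg p w i) (hno i)
        rw [map_sub] at h1
        linarith
      obtain ⟨i, hi⟩ := hex
      obtain ⟨q, l, hl, hq, hA', hD'⟩ := C.exists_step φ s p i hA hD
      have hgq : g (C.pt p) < g (C.pt q) := by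
        have : (0 : ℝ) < l := by exact_mod_cast hl
        rw [hq, map_add, map_smul, smul_eq_mul]
        nlinarith
      have hcard' : {r | g (C.pt q) < g (C.pt r)}.ncard ≤ m := by
        refine Nat.le_of_lt_succ (lt_of_lt_of_le (Set.ncard_lt_ncard ?_ (Set.toFinite _)) hcard)
        refine ⟨fun r hr => hgq.trans hr, fun hsub => ?_⟩
        have : q ∈ {r | g (C.pt q) < g (C.pt r)} := hsub hgq
        simp at this
      have h1 := ih q (K * A) (D + N * A) hA' hD' (by positivity) hcard'
      have h2 : A ≤ K ^ (m + 1) * A := le_mul_of_one_le_left hA0 (one_le_pow₀ hK1)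
      have h3 : (N : ℝ) * A ≤ N * (K ^ (m + 1) * A) :=
        mul_le_mul_of_nonneg_left h2 (Nat.cast_nonneg N)
      push_cast
      rw [pow_succ] at h3 ⊢
      linarith

/-- All vertices have bounded coordinates with respect to the basis at a fixed vertex. -/
theorem abs_repr_le (C : SmoothConfig ι V d N) [Fintype ι] (hι : Fintype.card ι ≤ N + 1)
    (p q : ι) (i : Fin d) :
    |(C.basis p).repr (C.pt q - C.pt p) i| ≤
      ((N + 1) * (N * (1 + (2 * (N + 1) + N)) ^ (N + 1)) : ℕ) := by
  obtain ⟨g, hg⟩ := C.exposed q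
  set φ := (C.basis p).coord i with hφ
  have hA : ∀ j, |φ (C.basis p j)| ≤ 1 := by
    intro j
    by_cases h : j = i <;> simp [hφ, h]
  have h1 := C.abs_le_of_walk φ (φ (C.pt p)) q g hg (N + 1) p 1 0 hA (by simp) zero_le_one
    ((Set.ncard_le_card _).trans (by rwa [Nat.card_eq_fintype_card]))
  have h2 : (Fintype.card ι : ℝ) ≤ N + 1 := by exact_mod_cast hι
  have h3 : (1 + (2 * Fintype.card ι + N) : ℝ) ^ (N + 1) ≤ (1 + (2 * (N + 1) + N)) ^ (N + 1) := by
    gcongr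
  have h4 : (C.basis p).repr (C.pt q - C.pt p) i = φ (C.pt q) - φ (C.pt p) := by simp [hφ]
  rw [h4]
  refine h1.trans ?_
  push_cast
  rw [zero_add, mul_one]
  gcongr

end SmoothConfig

/-! ### Convexity and lattice tools. -/

/-- Lets a large multiple of one functional dominate another at the finitely many vertices where the
first is positive. -/
theorem exists_forall_lt_mul {α : Type*} (S : Finset α) (a h : α → ℝ) :
    ∃ K : ℝ, 0 ≤ K ∧ ∀ s ∈ S, 0 < h s → a s < K * h s := by
  have h1 : ∀ s ∈ S, ∀ᶠ K : ℝ in Filter.atTop, 0 < h s → a s < K * h s := by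
    intro s _
    by_cases hs : 0 < h s
    · filter_upwards [Filter.eventually_gt_atTop (a s / h s)] with K hK _
      rwa [div_lt_iff₀ hs] at hK
    · exact Filter.Eventually.of_forall fun K h' => absurd h' hs
  obtain ⟨K, hK⟩ := ((Filter.eventually_ge_atTop (0 : ℝ)).and
    ((Filter.eventually_all_finset S).2 h1)).exists
  exact ⟨K, hK.1, hK.2⟩

theorem convexHull_le_of_forall_le {n : ℕ} {S : Set (Fin n → ℝ)} {l : (Fin n → ℝ) →ₗ[ℝ] ℝ} {c : ℝ}
    (h : ∀ x ∈ S, c ≤ l x) : ∀ x ∈ convexHull ℝ S, c ≤ l x :=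
  fun _ hx => convexHull_min h (convex_halfSpace_ge l.isLinear c) hx

/-- A point of a finite set at which a functional has a strict maximum is an exposed point of the
convex hull. -/
theorem isExposed_singleton_convexHull {n : ℕ} {S : Finset (Fin n → ℝ)} {p : Fin n → ℝ}
    (hp : p ∈ S) {g : StrongDual ℝ (Fin n → ℝ)} (hg : ∀ x ∈ S, x ≠ p → g x < g p) :
    IsExposed ℝ (convexHull ℝ (S : Set (Fin n → ℝ))) {p} := by
  have hpc : p ∈ convexHull ℝ (S : Set (Fin n → ℝ)) := subset_convexHull ℝ _ hp
  have hle : ∀ x ∈ S, g x ≤ g p := fun x hx => by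
    by_cases h : x = p
    · rw [h]
    · exact (hg x hx h).le
  refine fun _ => ⟨g, Set.Subset.antisymm ?_ ?_⟩
  · rintro x rfl
    refine ⟨hpc, fun y hy => ?_⟩
    exact convexHull_min hle (convex_halfSpace_le g.toLinearMap.isLinear (g x)) hy
  · rintro x ⟨hx, hmax⟩
    obtain ⟨w, hw0, hw1, rfl⟩ := Finset.mem_convexHull'.1 hx
    have h1 := hmax p hpc
    rw [map_sum] at h1
    simp only [map_smul, smul_eq_mul] at h1
    have h2 : ∑ y ∈ S, w y * (g p - g y) ≤ 0 := by
      simp only [mul_sub, Finset.sum_sub_distrib, ← Finset.sum_mul, hw1]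
      linarith
    have h3 : ∀ y ∈ S, 0 ≤ w y * (g p - g y) := fun y hy =>
      mul_nonneg (hw0 y hy) (sub_nonneg.2 (hle y hy))
    have h4 := (Finset.sum_eq_zero_iff_of_nonneg h3).1 (le_antisymm h2 (Finset.sum_nonneg h3))
    have h5 : ∀ y ∈ S, y ≠ p → w y = 0 := fun y hy hyp =>
      (mul_eq_zero.1 (h4 y hy)).resolve_right (sub_pos.2 (hg y hy hyp)).ne'
    have h6 : w p = 1 := by rwa [Finset.sum_eq_single_of_mem p hp h5] at hw1
    rw [Set.mem_singleton_iff, Finset.sum_eq_single_of_mem p hp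
      fun y hy hyp => by rw [h5 y hy hyp, zero_smul], h6, one_smul]

namespace IntLattice

variable {n : ℕ} {x y : Fin n → ℝ}

theorem add_mem (hx : x ∈ IntLattice n) (hy : y ∈ IntLattice n) : x + y ∈ IntLattice n := by
  intro i
  obtain ⟨a, ha⟩ := hx i
  obtain ⟨b, hb⟩ := hy i
  exact ⟨a + b, by simp [ha, hb]⟩

theorem intCast_smul_mem (k : ℤ) (hx : x ∈ IntLattice n) : (k : ℝ) • x ∈ IntLattice n := by
  intro i
  obtain ⟨a, ha⟩ := hx i
  exact ⟨k * a, by simp [ha]⟩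

theorem sub_mem (hx : x ∈ IntLattice n) (hy : y ∈ IntLattice n) : x - y ∈ IntLattice n := by
  have := add_mem hx (intCast_smul_mem (-1) hy)
  simpa [sub_eq_add_neg] using this

theorem sum_mem {α : Type*} (s : Finset α) {f : α → Fin n → ℝ} (hf : ∀ a ∈ s, f a ∈ IntLattice n) :
    ∑ a ∈ s, f a ∈ IntLattice n := by
  classical
  induction s using Finset.induction_on with
  | empty => exact fun i => ⟨0, by simp⟩
  | insert a s ha ih =>
    rw [Finset.sum_insert ha]
    exact add_mem (hf _ (Finset.mem_insert_self _ _))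
      (ih fun b hb => hf b (Finset.mem_insert_of_mem hb))

end IntLattice

/-! ### Vertices of a smooth polytope and their lattice bases. -/

namespace LatticePolytope

variable {n : ℕ}

/-- `S` is the set of vertices of `P`. -/
structure IsVertexSet (P : LatticePolytope n) (S : Finset (Fin n → ℝ)) : Prop where
  nonempty : S.Nonempty
  subset : ↑S ⊆ IntLattice n
  carrier_eq : P.carrier = convexHull ℝ (S : Set (Fin n → ℝ))
  exposed : ∀ p ∈ S, ∃ g : StrongDual ℝ (Fin n → ℝ), ∀ x ∈ S, x ≠ p → g x < g p

/-- A generating set of least cardinality works: no point lies in the hull of the others, so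
Hahn–Banach separates it strictly. -/
theorem exists_isVertexSet (P : LatticePolytope n) : ∃ S, P.IsVertexSet S := by
  classical
  obtain ⟨s, hs, hsub, hcar⟩ := P.exists_finset
  obtain ⟨S, hS, hmin⟩ := Finset.exists_min_image
    (s.powerset.filter fun T : Finset (Fin n → ℝ) => convexHull ℝ (T : Set (Fin n → ℝ)) = P.carrier) Finset.card
    ⟨s, by simp [hcar]⟩
  simp only [Finset.mem_filter, Finset.mem_powerset] at hS hmin
  refine ⟨S, ?_, fun x hx => hsub (hS.1 hx), hS.2.symm, fun p hp => ?_⟩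
  · have := P.carrier_nonempty
    rw [← hS.2, convexHull_nonempty_iff] at this
    exact_mod_cast this
  · have hnot : p ∉ convexHull ℝ ((S.erase p : Finset _) : Set (Fin n → ℝ)) := by
      intro hmem
      have h1 : convexHull ℝ ((S.erase p : Finset _) : Set (Fin n → ℝ)) = P.carrier := by
        rw [← hS.2]
        refine Set.Subset.antisymm (convexHull_mono (by simp))
          (convexHull_min (fun x hx => ?_) (convex_convexHull ℝ _))
        by_cases hxp : x = p
        · rwa [hxp]
        · exact subset_convexHull ℝ _ (Finset.mem_coe.2 (Finset.mem_erase.2 ⟨hxp, hx⟩))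
      have h2 := hmin _ ⟨(Finset.erase_subset _ _).trans hS.1, h1⟩
      have h3 := Finset.card_erase_lt_of_mem hp
      omega
    obtain ⟨g, u, hg, hu⟩ := geometric_hahn_banach_closed_point (convex_convexHull ℝ _)
      ((Finset.finite_toSet _).isClosed_convexHull ℝ) hnot
    exact ⟨g, fun x hx hxp => (hg x (subset_convexHull ℝ _
      (Finset.mem_coe.2 (Finset.mem_erase.2 ⟨hxp, hx⟩)))).trans hu⟩

theorem sub_mem_direction (P : LatticePolytope n) {x y : Fin n → ℝ} (hx : x ∈ P.carrier)
    (hy : y ∈ P.carrier) : x - y ∈ P.direction := vsub_mem_vectorSpan ℝ hx hy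

theorem IsVertexSet.mem_carrier {P : LatticePolytope n} {S : Finset (Fin n → ℝ)}
    (hS : P.IsVertexSet S) {x : Fin n → ℝ} (hx : x ∈ S) : x ∈ P.carrier := by
  rw [hS.carrier_eq]; exact subset_convexHull ℝ _ hx

theorem IsVertexSet.nonneg_of_forall_mem {P : LatticePolytope n} {S : Finset (Fin n → ℝ)}
    (hS : P.IsVertexSet S) {p : Fin n → ℝ} {φ : Module.Dual ℝ P.direction}
    (hφ : ∀ x ∈ S, ∀ v : P.direction, (v : Fin n → ℝ) = x - p → 0 ≤ φ v) (hp : p ∈ S) :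
    ∀ y ∈ P.carrier, ∀ v : P.direction, (v : Fin n → ℝ) = y - p → 0 ≤ φ v := by
  intro y hy v hv
  obtain ⟨l, hl⟩ := φ.exists_extend
  have hl' : ∀ v : P.direction, φ v = l v := fun v => by rw [← hl]; rfl
  rw [hl', hv, map_sub, sub_nonneg]
  rw [hS.carrier_eq] at hy
  refine convexHull_le_of_forall_le (fun x hx => ?_) y hy
  have h1 := hφ x hx ⟨x - p, P.sub_mem_direction (hS.mem_carrier hx) (hS.mem_carrier hp)⟩ rfl
  rw [hl', map_sub, sub_nonneg] at h1
  exact h1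

theorem IsVertexSet.mem_normalCone {P : LatticePolytope n} {S : Finset (Fin n → ℝ)}
    (hS : P.IsVertexSet S) {p : Fin n → ℝ} (hp : p ∈ S) {φ : Module.Dual ℝ P.direction} :
    φ ∈ P.normalCone {p} ↔
      ∀ x ∈ S, ∀ v : P.direction, (v : Fin n → ℝ) = x - p → 0 ≤ φ v := by
  rw [normalCone, PointedCone.mem_dual]
  constructor
  · intro h x hx v hv
    exact h ⟨p, rfl, x, hS.mem_carrier hx, hv⟩
  · rintro h v ⟨x, hx, y, hy, hv⟩
    rw [Set.mem_singleton_iff] at hx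
    subst hx
    exact hS.nonneg_of_forall_mem h hp y hy v hv

/-- The functional `γ = -g` is positive on all `x - p` with `x ≠ p` in `S`, so `φ + K • γ` is in the
cone for large `K`. Full dimension makes the generators of the cone a basis of the entire dual
lattice. -/
theorem IsVertexSet.span_normalCone {P : LatticePolytope n} {S : Finset (Fin n → ℝ)}
    (hS : P.IsVertexSet S) {p : Fin n → ℝ} (hp : p ∈ S) :
    Submodule.span ℝ (P.normalCone {p} : Set (Module.Dual ℝ P.direction)) = ⊤ := by
  obtain ⟨g, hg⟩ := hS.exposed p hp
  rw [eq_top_iff]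
  rintro φ -
  set γ : Module.Dual ℝ P.direction := -(g.toLinearMap ∘ₗ P.direction.subtype) with hγ
  obtain ⟨l, hl⟩ := φ.exists_extend
  have hl' : ∀ v : P.direction, φ v = l v := fun v => by rw [← hl]; rfl
  obtain ⟨K, hK, hK'⟩ := exists_forall_lt_mul S (fun x => -(l x - l p)) (fun x => g p - g x)
  have hγv : ∀ x, ∀ v : P.direction, (v : Fin n → ℝ) = x - p → γ v = g p - g x := by
    intro x v hv; simp [hγ, hv]
  have hγmem : γ ∈ P.normalCone {p} := by
    rw [hS.mem_normalCone hp]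
    intro x hx v hv
    rw [hγv x v hv]
    by_cases hxp : x = p
    · simp [hxp]
    · linarith [hg x hx hxp]
  have hmem : φ + K • γ ∈ P.normalCone {p} := by
    rw [hS.mem_normalCone hp]
    intro x hx v hv
    rw [LinearMap.add_apply, LinearMap.smul_apply, hγv x v hv, hl', hv, map_sub, smul_eq_mul]
    by_cases hxp : x = p
    · simp [hxp]
    · have := hK' x hx (by linarith [hg x hx hxp])
      linarith
  have : φ = (φ + K • γ) - K • γ := by abel
  rw [this]
  exact Submodule.sub_mem _ (Submodule.subset_span hmem)
    (Submodule.smul_mem _ _ (Submodule.subset_span hγmem))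

/-- `b` consists of the primitive edge directions of `P` at `p`, and it is a lattice basis. -/
structure IsVertexBasis (P : LatticePolytope n) (S : Finset (Fin n → ℝ)) (p : Fin n → ℝ)
    (b : Module.Basis (Fin P.dim) ℝ P.direction) : Prop where
  exists_int : ∀ i, ∀ v : P.direction, (v : Fin n → ℝ) ∈ IntLattice n → ∃ k : ℤ, b.repr v i = k
  mem_intLattice : ∀ i, (b i : Fin n → ℝ) ∈ IntLattice n
  nonneg : ∀ i, ∀ x ∈ P.carrier, ∀ v : P.direction, (v : Fin n → ℝ) = x - p → 0 ≤ b.repr v i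
  nonneg_of_forall_nonneg : ∀ φ : Module.Dual ℝ P.direction,
    (∀ x ∈ S, ∀ v : P.direction, (v : Fin n → ℝ) = x - p → 0 ≤ φ v) → ∀ i, 0 ≤ φ (b i)

/-- The primitive edge directions at a vertex of a smooth polytope form a lattice basis. -/
theorem IsVertexSet.exists_basis {P : LatticePolytope n} {S : Finset (Fin n → ℝ)}
    (hS : P.IsVertexSet S) (hP : P.IsSmooth) {p : Fin n → ℝ} (hp : p ∈ S) :
    ∃ b : Module.Basis (Fin P.dim) ℝ P.direction, P.IsVertexBasis S p b := by
  classical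
  obtain ⟨g, hg⟩ := hS.exposed p hp
  have hface : P.IsFace {p} := ⟨Set.singleton_nonempty p, by
    rw [hS.carrier_eq]; exact isExposed_singleton_convexHull hp hg⟩
  obtain ⟨B, hli, hint, hgen⟩ := hP _ ⟨{p}, hface, rfl⟩
  rw [hS.span_normalCone hp] at hint
  simp only [Submodule.top_coe, Set.inter_univ] at hint
  have hBmem : ∀ β ∈ B, β ∈ P.normalCone {p} := fun β hβ => by
    rw [hgen]; exact PointedCone.subset_hull hβ
  have hspan : ⊤ ≤ Submodule.span ℝ (Set.range fun b : B => (b : Module.Dual ℝ P.direction)) := by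
    rw [← hS.span_normalCone hp, Submodule.span_le, hgen]
    intro x hx
    have := PointedCone.hull_le_span (R := ℝ) _ hx
    simpa using this
  let β := Module.Basis.mk hli hspan
  have hβ : ∀ i, β i = i := fun i => by simp [β]
  -- The edge directions are dual to the generators of the normal cone, so coordinates in `u'` are
  -- the values of these generators.
  let u' : Module.Basis B ℝ P.direction := β.dualBasis.map (Module.evalEquiv ℝ P.direction).symm
  have hu' : ∀ i j : B, (i : Module.Dual ℝ P.direction) (u' j) = if i = j then 1 else 0 := by
    intro i j
    have h1 : (Module.evalEquiv ℝ P.direction) (u' j) = β.dualBasis j := by simp [u']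
    have h2 := congrArg (fun ψ => ψ (β i)) h1
    simp only [Module.evalEquiv_apply, Module.Basis.dualBasis_apply_self] at h2
    rw [Module.Dual.eval_apply, hβ] at h2
    rw [h2]
  have hrepr : ∀ v i, u'.repr v i = (i : Module.Dual ℝ P.direction) v := by
    intro v i
    conv_rhs => rw [← u'.sum_repr v]
    simp [hu']
  have hcard : Fintype.card B = P.dim := (Module.finrank_eq_card_basis u').symm
  let e : B ≃ Fin P.dim := Fintype.equivFinOfCardEq hcard
  refine ⟨u'.reindex e, fun i v hv => ?_, fun i => ?_, fun i x hx v hv => ?_, fun φ hφ i => ?_⟩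
  · have h1 : ((e.symm i : B) : Module.Dual ℝ P.direction) ∈ P.dualLattice := by
      rw [← hint]; exact Submodule.subset_span (e.symm i).2
    obtain ⟨k, hk⟩ := h1 v hv
    exact ⟨k, by simp [hrepr, hk]⟩
  · intro m
    -- The ambient coordinates belong to the dual lattice, hence are integer combinations of the
    -- generators and take integer values on `u'`.
    have h1 : (LinearMap.proj m ∘ₗ P.direction.subtype : Module.Dual ℝ P.direction) ∈
        P.dualLattice := fun v hv => hv m
    rw [← hint, SetLike.mem_coe, Submodule.mem_span_finset'] at h1
    obtain ⟨f, hf⟩ := h1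
    have h2 := congrArg (fun ψ : Module.Dual ℝ P.direction => ψ (u' (e.symm i))) hf
    simp only [LinearMap.sum_apply, LinearMap.smul_apply, hu'] at h2
    simp at h2
    refine ⟨f (e.symm i), ?_⟩
    rw [Module.Basis.reindex_apply, ← h2]
  · rw [Module.Basis.repr_reindex_apply, hrepr]
    exact hS.nonneg_of_forall_mem ((hS.mem_normalCone hp).1 (hBmem _ (e.symm i).2)) hp x hx v hv
  · have h1 := (hS.mem_normalCone hp).2 hφ
    rw [hgen, PointedCone.hull, Submodule.mem_span_finset'] at h1
    obtain ⟨f, hf⟩ := h1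
    rw [← hf, Module.Basis.reindex_apply, LinearMap.sum_apply]
    refine Finset.sum_nonneg fun j _ => ?_
    change 0 ≤ (f j : ℝ) * (j : Module.Dual ℝ P.direction) (u' (e.symm i))
    rw [hu']
    exact mul_nonneg (f j).2 (by split_ifs <;> simp)

end LatticePolytope

/-! ### Edges at a vertex and their lattice points. -/

namespace LatticePolytope

variable {n : ℕ}

namespace IsVertexBasis

variable {P : LatticePolytope n} {S : Finset (Fin n → ℝ)} {p : Fin n → ℝ}
  {b : Module.Basis (Fin P.dim) ℝ P.direction}

theorem eq_add_smul (hp : p ∈ P.carrier) {x : Fin n → ℝ} (hx : x ∈ P.carrier) {i : Fin P.dim}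
    (h : ∀ j, j ≠ i → b.repr ⟨x - p, P.sub_mem_direction hx hp⟩ j = 0) :
    x = p + b.repr ⟨x - p, P.sub_mem_direction hx hp⟩ i • (b i : Fin n → ℝ) := by
  have h1 := b.sum_repr ⟨x - p, P.sub_mem_direction hx hp⟩
  rw [Finset.sum_eq_single i (fun j _ hj => by rw [h j hj, zero_smul]) (by simp)] at h1
  have h2 := congrArg (Subtype.val) h1
  simp only [Submodule.coe_smul] at h2
  rw [h2]
  abel

theorem repr_of_eq (hp : p ∈ P.carrier) {x : Fin n → ℝ} (hx : x ∈ P.carrier) {i : Fin P.dim}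
    {t : ℝ} (h : x = p + t • (b i : Fin n → ℝ)) :
    (⟨x - p, P.sub_mem_direction hx hp⟩ : P.direction) = t • b i := by
  apply Subtype.ext
  simp [h]

/-- The edges at a vertex of a smooth polytope are spanned by the directions in the vertex basis. -/
theorem exists_adjacent (hS : P.IsVertexSet S) (hp : p ∈ S) (hb : P.IsVertexBasis S p b)
    (i : Fin P.dim) : ∃ q ∈ S, ∃ l : ℕ, 1 ≤ l ∧ q = p + (l : ℝ) • (b i : Fin n → ℝ) ∧
      ∀ r ∈ S, ∀ t : ℝ, r = p + t • (b i : Fin n → ℝ) → t ≤ l := by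
  classical
  have hpc := hS.mem_carrier hp
  -- If no other vertex lay on the ray, then for large `K` the functional `K • ∑ j ≠ i, coord j -
  -- coord i` would be nonnegative on all `x - p`, yet it is `-1` at `b i`.
  have hex : ∃ x ∈ S, ∃ t : ℝ, 0 < t ∧ x = p + t • (b i : Fin n → ℝ) := by
    by_contra! hno
    choose L hL using fun j => (b.coord j).exists_extend
    have hL' : ∀ j (v : P.direction), L j v = b.repr v j := fun j v => by
      rw [← Module.Basis.coord_apply, ← hL]; rfl
    obtain ⟨K, hK, hK'⟩ := exists_forall_lt_mul S (fun x => L i (x - p))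
      (fun x => ∑ j ∈ Finset.univ.erase i, L j (x - p))
    have h1 := hb.nonneg_of_forall_nonneg
      (K • ∑ j ∈ Finset.univ.erase i, b.coord j - b.coord i) (fun x hx v hv => ?_) i
    · simp only [LinearMap.sub_apply, LinearMap.smul_apply, LinearMap.sum_apply,
        Module.Basis.coord_apply, Module.Basis.repr_self, Finsupp.single_eq_same] at h1
      rw [Finset.sum_eq_zero fun j hj => Finsupp.single_eq_of_ne (Finset.ne_of_mem_erase hj)] at h1
      norm_num at h1
    · have hxc := hS.mem_carrier hx
      have hK1 := hK' x hx
      simp only [← hv, hL'] at hK1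
      simp only [LinearMap.sub_apply, LinearMap.smul_apply, LinearMap.sum_apply,
        Module.Basis.coord_apply, smul_eq_mul, sub_nonneg]
      have h0 : ∀ j ∈ Finset.univ.erase i, 0 ≤ b.repr v j := fun j _ => hb.nonneg j x hxc v hv
      rcases (Finset.sum_nonneg h0).lt_or_eq with hpos | hzero
      · exact (hK1 hpos).le
      · rw [← hzero, mul_zero]
        have hz := (Finset.sum_eq_zero_iff_of_nonneg h0).1 hzero.symm
        have hveq : v = ⟨x - p, P.sub_mem_direction hxc hpc⟩ := Subtype.ext hv
        have := eq_add_smul (b := b) hpc hxc (i := i) fun j hj => by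
          rw [← hveq]; exact hz j (Finset.mem_erase.2 ⟨hj, Finset.mem_univ j⟩)
        rw [← hveq] at this
        by_contra! hlt
        exact hno x hx _ hlt this
  obtain ⟨x, hx, t, ht, hxt⟩ := hex
  have hbi : (b i : Fin n → ℝ) ≠ 0 := fun h => b.ne_zero i (Subtype.ext h)
  choose! τ hτ using fun (y : Fin n → ℝ)
    (h : ∃ t : ℝ, y = p + t • (b i : Fin n → ℝ)) => h
  have hinj : ∀ s t : ℝ, p + s • (b i : Fin n → ℝ) = p + t • (b i : Fin n → ℝ) → s = t :=
    fun s t h => smul_left_injective ℝ hbi (add_left_cancel h)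
  have hτ' : ∀ t : ℝ, τ (p + t • (b i : Fin n → ℝ)) = t := fun t =>
    (hinj _ _ (hτ _ ⟨t, rfl⟩)).symm
  -- The farthest vertex on the line is the other end of the edge; its parameter is a coordinate of
  -- a lattice vector, hence an integer.
  obtain ⟨q, hq, hmax⟩ := Finset.exists_max_image
    (S.filter fun y => ∃ t : ℝ, y = p + t • (b i : Fin n → ℝ)) τ
    ⟨x, Finset.mem_filter.2 ⟨hx, t, hxt⟩⟩
  obtain ⟨hqS, s, hs⟩ := Finset.mem_filter.1 hq
  have hts : t ≤ s := by
    have h1 := hmax x (Finset.mem_filter.2 ⟨hx, t, hxt⟩)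
    rwa [hxt, hs, hτ', hτ'] at h1
  obtain ⟨k, hk⟩ := hb.exists_int i ⟨q - p, P.sub_mem_direction (hS.mem_carrier hqS) hpc⟩
    (IntLattice.sub_mem (hS.subset hqS) (hS.subset hp))
  rw [repr_of_eq hpc (hS.mem_carrier hqS) hs] at hk
  simp at hk
  have hk0 : 0 < k := by
    have : (0 : ℝ) < k := by rw [← hk]; linarith
    exact_mod_cast this
  lift k to ℕ using hk0.le
  simp only [Int.cast_natCast] at hk
  refine ⟨q, hqS, k, by omega, by rw [hs, hk], fun r hr t' ht' => ?_⟩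
  have h1 := hmax r (Finset.mem_filter.2 ⟨hr, t', ht'⟩)
  rwa [ht', hs, hτ', hτ', hk] at h1

/-- The line through `p` along `b i` meets `P` in the set where the other coordinates vanish. Their
negated sum exposes it, and `exists_adjacent` supplies a second point, so it is an edge. -/
theorem mem_edgeLatticePoints (hS : P.IsVertexSet S) (hp : p ∈ S) (hb : P.IsVertexBasis S p b)
    (i : Fin P.dim) {x : Fin n → ℝ} (hx : x ∈ P.carrier) {t : ℝ}
    (ht : x = p + t • (b i : Fin n → ℝ)) (hxI : x ∈ IntLattice n) :
    x ∈ P.edgeLatticePoints := by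
  classical
  have hpc := hS.mem_carrier hp
  have hbi : (b i : Fin n → ℝ) ≠ 0 := fun h => b.ne_zero i (Subtype.ext h)
  choose L hL using fun j => (b.coord j).exists_extend
  have hL' : ∀ j (v : P.direction), L j v = b.repr v j := fun j v => by
    rw [← Module.Basis.coord_apply, ← hL]; rfl
  have hLi : ∀ j, j ≠ i → L j (b i) = 0 := fun j hj => by
    rw [hL', Module.Basis.repr_self, Finsupp.single_eq_of_ne hj]
  have hLnn : ∀ j, ∀ y ∈ P.carrier, 0 ≤ L j (y - p) := fun j y hy => by
    have := hb.nonneg j y hy ⟨y - p, P.sub_mem_direction hy hpc⟩ rfl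
    rwa [← hL'] at this
  set F : Set (Fin n → ℝ) := {y | y ∈ P.carrier ∧ ∃ t : ℝ, y = p + t • (b i : Fin n → ℝ)} with hF
  have hpF : p ∈ F := ⟨hpc, 0, by simp⟩
  refine ⟨hxI, F, ⟨⟨⟨p, hpF⟩, fun _ => ?_⟩, ?_⟩, hx, t, ht⟩
  · set l : (Fin n → ℝ) →ₗ[ℝ] ℝ := ∑ j ∈ Finset.univ.erase i, L j with hl
    have hlp : ∀ y ∈ P.carrier, 0 ≤ l (y - p) := fun y hy => by
      rw [hl, LinearMap.sum_apply]; exact Finset.sum_nonneg fun j _ => hLnn j y hy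
    refine ⟨LinearMap.toContinuousLinearMap (-l), Set.Subset.antisymm ?_ ?_⟩
    · rintro y ⟨hy, s, hs⟩
      refine ⟨hy, fun z hz => ?_⟩
      have h1 : l (b i) = 0 := by
        rw [hl, LinearMap.sum_apply]
        exact Finset.sum_eq_zero fun j hj => hLi j (Finset.ne_of_mem_erase hj)
      have h2 := hlp z hz
      rw [map_sub] at h2
      simp [hs, h1]
      linarith
    · rintro y ⟨hy, hmax⟩
      have h1 := hmax p hpc
      simp only [LinearMap.coe_toContinuousLinearMap', LinearMap.neg_apply, neg_le_neg_iff] at h1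
      have h2 : l (y - p) = 0 := le_antisymm (by rw [map_sub]; linarith) (hlp y hy)
      rw [hl, LinearMap.sum_apply] at h2
      have h3 := (Finset.sum_eq_zero_iff_of_nonneg fun j _ => hLnn j y hy).1 h2
      exact ⟨hy, _, eq_add_smul (b := b) hpc hy fun j hj => by
        rw [← hL']; exact h3 j (Finset.mem_erase.2 ⟨hj, Finset.mem_univ j⟩)⟩
  · have hspan : vectorSpan ℝ F = Submodule.span ℝ {(b i : Fin n → ℝ)} := by
      apply le_antisymm
      · rw [vectorSpan_def, Submodule.span_le]
        rintro _ ⟨y, ⟨-, s, rfl⟩, z, ⟨-, s', rfl⟩, rfl⟩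
        exact Submodule.mem_span_singleton.2 ⟨s - s', by simp [sub_smul]⟩
      · rw [Submodule.span_singleton_le_iff_mem]
        obtain ⟨q, hq, l, hl, hql, -⟩ := hb.exists_adjacent hS hp i
        have h1 : q - p ∈ vectorSpan ℝ F :=
          vsub_mem_vectorSpan ℝ ⟨hS.mem_carrier hq, l, hql⟩ hpF
        rw [hql, add_sub_cancel_left] at h1
        exact (Submodule.smul_mem_iff _ (by positivity)).1 h1
    rw [hspan, finrank_span_singleton hbi]

theorem length_le (hS : P.IsVertexSet S) (hp : p ∈ S) (hb : P.IsVertexBasis S p b)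
    {N : ℕ} (hN : P.edgeLatticePoints.ncard = N + 1) {i : Fin P.dim} {l : ℕ}
    (hq : p + (l : ℝ) • (b i : Fin n → ℝ) ∈ S) : l ≤ N := by
  -- `Set.ncard` is `0` on infinite sets, so the value `N + 1` forces finiteness.
  have hfin : P.edgeLatticePoints.Finite := Set.finite_of_ncard_ne_zero (by omega)
  have hbi : (b i : Fin n → ℝ) ≠ 0 := fun h => b.ne_zero i (Subtype.ext h)
  have hpc := hS.mem_carrier hp
  have hsub : (fun k : ℕ => p + (k : ℝ) • (b i : Fin n → ℝ)) '' (Set.Iic l) ⊆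
      P.edgeLatticePoints := by
    rintro _ ⟨k, hk, rfl⟩
    refine hb.mem_edgeLatticePoints hS hp i ?_ rfl (IntLattice.add_mem (hS.subset hp) ?_)
    · have hconv : Convex ℝ P.carrier := by rw [hS.carrier_eq]; exact convex_convexHull ℝ _
      rcases Nat.eq_zero_or_pos l with h0 | h0
      · have : k = 0 := by rw [h0] at hk; simpa using hk
        simpa [this] using hpc
      · have hl : (0 : ℝ) < l := by exact_mod_cast h0
        have hkl : (k : ℝ) ≤ l := by exact_mod_cast hk
        have h1 := hconv.add_smul_mem hpc (hS.mem_carrier hq)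
          (t := (k : ℝ) / l) ⟨by positivity, (div_le_one hl).2 hkl⟩
        rwa [smul_smul, div_mul_cancel₀ _ hl.ne'] at h1
    · exact IntLattice.intCast_smul_mem k (hb.mem_intLattice i)
  have h1 := Set.ncard_le_ncard hsub hfin
  rw [Set.ncard_image_of_injective _ fun a c h => ?_, hN] at h1
  · have : (Set.Iic l).ncard = l + 1 := by
      rw [← Finset.coe_Iic, Set.ncard_coe_finset, Nat.card_Iic]
    omega
  · exact_mod_cast smul_left_injective ℝ hbi (add_left_cancel h)

end IsVertexBasis

theorem IsVertexSet.card_le {P : LatticePolytope n} {S : Finset (Fin n → ℝ)}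
    (hS : P.IsVertexSet S) (hP : P.IsSmooth) {N : ℕ} (hN : P.edgeLatticePoints.ncard = N + 1) :
    S.card ≤ N + 1 := by
  rcases Nat.eq_zero_or_pos P.dim with h0 | h0
  · have hbot : P.direction = ⊥ := Submodule.finrank_eq_zero.1 h0
    have : S.card ≤ 1 := Finset.card_le_one.2 fun x hx y hy => by
      have h1 := P.sub_mem_direction (hS.mem_carrier hx) (hS.mem_carrier hy)
      rw [hbot, Submodule.mem_bot] at h1
      exact sub_eq_zero.1 h1
    omega
  · have hfin : P.edgeLatticePoints.Finite := Set.finite_of_ncard_ne_zero (by omega)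
    rw [← hN, ← Set.ncard_coe_finset]
    refine Set.ncard_le_ncard (fun p hp => ?_) hfin
    obtain ⟨b, hb⟩ := hS.exists_basis hP hp
    exact hb.mem_edgeLatticePoints hS hp ⟨0, h0⟩ (hS.mem_carrier hp) (t := 0) (by simp)
      (hS.subset hp)

end LatticePolytope

/-! ### Placing an equivalent copy in a box. -/

namespace LatticePolytope

variable {n : ℕ}

/-- The configuration of the vertices of a smooth polytope, relative to a base vertex `o`. -/
theorem IsVertexSet.exists_smoothConfig {P : LatticePolytope n} {S : Finset (Fin n → ℝ)}
    (hS : P.IsVertexSet S) (hP : P.IsSmooth) {N : ℕ} (hN : P.edgeLatticePoints.ncard = N + 1)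
    {o : Fin n → ℝ} (ho : o ∈ S) :
    ∃ C : SmoothConfig S P.direction P.dim N,
      (∀ s : S, P.IsVertexBasis S s (C.basis s)) ∧
      ∀ s : S, (C.pt s : Fin n → ℝ) = (s : Fin n → ℝ) - o := by
  choose b hb using fun s : S => hS.exists_basis hP s.2
  have hc : ∀ s : S, (s : Fin n → ℝ) ∈ P.carrier := fun s => hS.mem_carrier s.2
  have hoc := hS.mem_carrier ho
  have hiff : ∀ (p q : S) (t : ℝ) (i : Fin P.dim),
      ((⟨q - o, P.sub_mem_direction (hc q) hoc⟩ : P.direction) =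
        ⟨p - o, P.sub_mem_direction (hc p) hoc⟩ + t • b p i) ↔
      (q : Fin n → ℝ) = p + t • (b p i : Fin n → ℝ) := by
    intro p q t i
    rw [Subtype.ext_iff]
    simp only [Submodule.coe_add, Submodule.coe_smul]
    constructor
    · intro h
      have := congrArg (· + o) h
      simpa [sub_add_eq_add_sub] using this
    · intro h
      rw [h]; abel
  refine ⟨{ pt := fun s => ⟨s - o, P.sub_mem_direction (hc s) hoc⟩
            basis := b
            exists_int := fun p q i j => (hb p).exists_int i _ ((hb q).mem_intLattice j)
            nonneg := fun p q i => (hb p).nonneg i q (hc q) _ (by simp)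
            edge := ?_
            exposed := ?_ }, hb, fun s => rfl⟩
  · intro p i
    obtain ⟨q, hq, l, hl, hql, hmax⟩ := (hb p).exists_adjacent hS p.2 i
    refine ⟨⟨q, hq⟩, l, hl, (hb p).length_le hS p.2 hN (hql ▸ hq), (hiff _ _ _ _).2 hql, ?_⟩
    intro r t hrt
    exact hmax r r.2 t ((hiff _ _ _ _).1 hrt)
  · intro p
    obtain ⟨g, hg⟩ := hS.exposed p p.2
    refine ⟨g.toLinearMap ∘ₗ P.direction.subtype, fun q hq => ?_⟩
    have := hg q q.2 fun h => hq (Subtype.ext h)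
    simpa using this

/-- An injective affine map that preserves and reflects lattice points induces an integral
equivalence between a polytope and its image. -/
theorem integrallyEquivalent_of_image {d : ℕ} {Q : LatticePolytope d} {P : LatticePolytope n}
    (φ : (Fin d → ℝ) →ᵃ[ℝ] (Fin n → ℝ)) (hφ : Function.Injective φ)
    (himage : φ '' Q.carrier = P.carrier) (hlat : ∀ x, φ x ∈ IntLattice n ↔ x ∈ IntLattice d) :
    IntegrallyEquivalent Q P := by
  have hspan : (affineSpan ℝ Q.carrier).map φ = affineSpan ℝ P.carrier := by
    rw [AffineSubspace.map_span, himage]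
  have : Nonempty ((affineSpan ℝ Q.carrier).map φ) := by rw [hspan]; infer_instance
  let e := ((affineSpan ℝ Q.carrier).equivMapOfInjective φ hφ).trans
    (AffineEquiv.ofEq _ _ hspan)
  have he : ∀ x, (e x : Fin n → ℝ) = φ x := fun x => rfl
  refine ⟨e, ?_, ?_⟩
  · ext y
    obtain ⟨x, rfl⟩ := e.surjective y
    rw [e.injective.mem_set_image, Set.mem_ofPred_eq, Set.mem_ofPred_eq, he, hlat]
  · ext y
    obtain ⟨x, rfl⟩ := e.surjective y
    rw [e.injective.mem_set_image, Set.mem_ofPred_eq, Set.mem_ofPred_eq, he, ← himage,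
      hφ.mem_set_image]

theorem finite_intLattice_box (d B : ℕ) : {x ∈ IntLattice d | ∀ i, |x i| ≤ B}.Finite := by
  refine ((Set.Finite.pi' fun _ : Fin d => Set.finite_Icc (-B : ℤ) B).image
    fun (k : Fin d → ℤ) i => (k i : ℝ)).subset ?_
  rintro x ⟨hx, hB⟩
  choose k hk using hx
  refine ⟨k, fun i => ?_, funext fun i => (hk i).symm⟩
  have h1 := abs_le.1 (hB i)
  rw [hk] at h1
  exact ⟨by exact_mod_cast h1.1, by exact_mod_cast h1.2⟩

theorem carrier_injective (d : ℕ) :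
    Function.Injective (carrier : LatticePolytope d → Set (Fin d → ℝ)) := by
  rintro ⟨A, hA⟩ ⟨B, hB⟩ h
  simpa using h

/-- There are only finitely many lattice polytopes in a bounded region. -/
theorem finite_box (d B : ℕ) : {Q : LatticePolytope d | ∃ T : Set (Fin d → ℝ),
    T ⊆ {x ∈ IntLattice d | ∀ i, |x i| ≤ B} ∧ Q.carrier = convexHull ℝ T}.Finite := by
  refine Set.Finite.of_finite_image (f := carrier) ?_ (carrier_injective d).injOn
  refine ((finite_intLattice_box d B).finite_subsets.image fun T => convexHull ℝ T).subset ?_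
  rintro _ ⟨Q, ⟨T, hT, hQ⟩, rfl⟩
  exact ⟨T, hT, hQ.symm⟩

/-- A smooth polytope is equivalent to a polytope in a box whose size depends only on the number of
lattice points on the edges. -/
theorem exists_equivalent_in_box (P : LatticePolytope n) (hP : P.IsSmooth) {N : ℕ}
    (hN : P.edgeLatticePoints.ncard = N + 1) :
    ∃ Q : LatticePolytope P.dim, IntegrallyEquivalent Q P ∧ ∃ T : Set (Fin P.dim → ℝ),
      T ⊆ {x ∈ IntLattice P.dim |
        ∀ i, |x i| ≤ ((N + 1) * (N * (1 + (2 * (N + 1) + N)) ^ (N + 1)) : ℕ)} ∧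
      Q.carrier = convexHull ℝ T := by
  classical
  obtain ⟨S, hS⟩ := P.exists_isVertexSet
  obtain ⟨o, ho⟩ := hS.nonempty
  obtain ⟨C, hb, hpt⟩ := hS.exists_smoothConfig hP hN ho
  set b := C.basis ⟨o, ho⟩
  have hbo := hb ⟨o, ho⟩
  have hpto : C.pt ⟨o, ho⟩ = 0 := Subtype.ext (by rw [hpt]; simp)
  let T : Finset (Fin P.dim → ℝ) := Finset.univ.image fun s : S => b.equivFun (C.pt s)
  have hTint : (T : Set (Fin P.dim → ℝ)) ⊆ IntLattice P.dim := by
    intro x hx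
    obtain ⟨s, -, rfl⟩ := Finset.mem_image.1 (Finset.mem_coe.1 hx)
    intro i
    rw [Module.Basis.equivFun_apply]
    exact hbo.exists_int i _ (by rw [hpt]; exact IntLattice.sub_mem (hS.subset s.2) (hS.subset ho))
  let Q : LatticePolytope P.dim := ⟨convexHull ℝ T, T, ⟨_, Finset.mem_image.2
    ⟨⟨o, ho⟩, Finset.mem_univ _, rfl⟩⟩, hTint, rfl⟩
  -- The inverse of the coordinate map at `o`; since `b` is a lattice basis, `φ` preserves and
  -- reflects lattice points.
  let φ : (Fin P.dim → ℝ) →ᵃ[ℝ] (Fin n → ℝ) :=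
    (P.direction.subtype ∘ₗ b.equivFun.symm.toLinearMap).toAffineMap + AffineMap.const ℝ _ o
  have hφ : ∀ x, φ x = (b.equivFun.symm x : Fin n → ℝ) + o := fun x => rfl
  refine ⟨Q, integrallyEquivalent_of_image φ ?_ ?_ ?_, T, fun x hx => ⟨hTint hx, ?_⟩, rfl⟩
  · intro x y hxy
    rw [hφ, hφ] at hxy
    exact b.equivFun.symm.injective (Subtype.ext (add_right_cancel hxy))
  · change φ '' convexHull ℝ (T : Set (Fin P.dim → ℝ)) = _
    rw [AffineMap.image_convexHull, hS.carrier_eq]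
    congr 1
    ext y
    constructor
    · rintro ⟨x, hx, rfl⟩
      obtain ⟨s, -, rfl⟩ := Finset.mem_image.1 (Finset.mem_coe.1 hx)
      rw [hφ, LinearEquiv.symm_apply_apply, hpt, sub_add_cancel]
      exact s.2
    · intro hy
      refine ⟨b.equivFun (C.pt ⟨y, hy⟩), Finset.mem_coe.2 (Finset.mem_image.2
        ⟨⟨y, hy⟩, Finset.mem_univ _, rfl⟩), ?_⟩
      rw [hφ, LinearEquiv.symm_apply_apply, hpt, sub_add_cancel]
  · intro x
    rw [hφ]
    constructor
    · intro h i
      have h1 := IntLattice.sub_mem h (hS.subset ho)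
      rw [add_sub_cancel_right] at h1
      obtain ⟨k, hk⟩ := hbo.exists_int i _ h1
      refine ⟨k, ?_⟩
      rw [← hk, ← Module.Basis.equivFun_apply, LinearEquiv.apply_symm_apply]
    · intro h
      refine IntLattice.add_mem ?_ (hS.subset ho)
      rw [Module.Basis.equivFun_symm_apply, Submodule.coe_sum]
      refine IntLattice.sum_mem _ fun i _ => ?_
      obtain ⟨k, hk⟩ := h i
      rw [hk, Submodule.coe_smul]
      exact IntLattice.intCast_smul_mem k (hbo.mem_intLattice i)
  · obtain ⟨s, -, rfl⟩ := Finset.mem_image.1 (Finset.mem_coe.1 hx)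
    intro i
    have := C.abs_repr_le (by rw [Fintype.card_coe]; exact hS.card_le hP hN) ⟨o, ho⟩ s i
    rwa [hpto, sub_zero] at this

end LatticePolytope

theorem mainTheorem4 (d N : ℕ) :
    {c : Quotient LatticePolytope.integralSetoid |
      ∃ (n : ℕ) (P : LatticePolytope n),
        Quotient.mk LatticePolytope.integralSetoid ⟨n, P⟩ = c ∧
        P.IsSmooth ∧ P.dim = d ∧ P.edgeLatticePoints.ncard = N + 1}.Finite := by
  refine ((LatticePolytope.finite_box d
    ((N + 1) * (N * (1 + (2 * (N + 1) + N)) ^ (N + 1)))).image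
    fun Q => Quotient.mk LatticePolytope.integralSetoid ⟨d, Q⟩).subset ?_
  rintro _ ⟨n, P, rfl, hP, rfl, hN⟩
  obtain ⟨Q, hQP, hT⟩ := P.exists_equivalent_in_box hP hN
  exact ⟨Q, hT, Quotient.sound hQP⟩
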